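/- Let $\mathbb{F}$ be a field and let $\mathfrak{L}$ be a non-zero finite-dimensional nilpotent left Leibniz algebra over $\mathbb{F}$, i.e. a non-zero finite-dimensional $\mathbb{F}$-vector space with a bilinear multiplication satisfying $x(yz)=(xy)z+y(xz)$ for all $x,y,z\in\mathfrak{L}$, for which there is a positive integer $r$ such that every product of $r$ elements of $\mathfrak{L}$, no matter how associated, is zero. For an $\mathfrak{L}$-bimodule $M$ and $n\ge 0$ let $\mathrm{CL}^n(\mathfrak{L},M):=\mathrm{Hom}_\mathbb{F}(\mathfrak{L}^{\otimes n},M)$, let $\mathrm{d}^n:\mathrm{CL}^n(\mathfrak{L},M)\to\mathrm{CL}^{n+1}(\mathfrak{L},M)$ be given by $$\begin{aligned}(\mathrm{d}^nf)(x_1\otimes\dots\otimes x_{n+1})&=\sum_{j=1}^n(-1)^{j+1}x_j\cdot f(x_1\otimes\dots\otimes\hat{x}_j\otimes\dots\otimes x_{n+1})+(-1)^{n+1}f(x_1\otimes\dots\otimes x_n)\cdot x_{n+1}\\&\quad+\sum_{1\le i<j\le n+1}(-1)^if(x_1\otimes\dots\otimes\hat{x}_i\otimes\dots\otimes x_{j-1}\otimes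 x_ix_j\otimes x_{j+1}\otimes\dots\otimes x_{n+1}),\end{aligned}$$ and let $\mathrm{HL}^n(\mathfrak{L},M):=\mathrm{Ker}(\mathrm{d}^n)/\mathrm{Im}(\mathrm{d}^{n-1})$, where $\mathrm{d}^{-1}:=0$. Then, for $\mathbb{F}$ regarded as the trivial $\mathfrak{L}$-bimodule ($x\cdot m=0=m\cdot x$ for all $x\in\mathfrak{L}$, $m\in\mathbb{F}$), $$\mathrm{HL}^n(\mathfrak{L},\mathbb{F})\neq 0\quad\text{for every integer } n\ge 0.$$ -/

import Mathlib

namespace LeibnizCoh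

/-- A (not necessarily unital, associative or commutative) ring `L` is a left Leibniz ring if every
left multiplication operator is a derivation.  An `F`-algebra in the sense of a vector space with a
bilinear multiplication is a `NonUnitalNonAssocRing` with a module structure such that
`IsScalarTower F L L` and `SMulCommClass F L L` hold. -/
class IsLeftLeibniz (L : Type*) [NonUnitalNonAssocRing L] : Prop where
  leibniz : ∀ x y z : L, x * (y * z) = (x * y) * z + y * (x * z)

/-- An algebra is nilpotent if there is a positive integer `n` such that every product of `n`
elements, no matter how associated, is zero.  The elements of `FreeMagma L` are the bracketed words
in elements of `L`; `FreeMagma.lift id` evaluates such a word in `L`. -/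
def IsNilpotentAlg (L : Type*) [NonUnitalNonAssocRing L] : Prop :=
  ∃ n : ℕ, 0 < n ∧ ∀ w : FreeMagma L, w.length = n → FreeMagma.lift (id : L → L) w = 0

section

variable (F : Type*) [Field F]
  (L : Type*) [NonUnitalNonAssocRing L] [Module F L] [IsScalarTower F L L] [SMulCommClass F L L]
  (M : Type*) [AddCommGroup M] [Module F M]

/-- The structure of a Leibniz bimodule over the left Leibniz algebra `L` on the vector space `M`;
`left x m` is `x · m` and `right m x` is `m · x`. -/
structure Bimodule where
  left : L →ₗ[F] M →ₗ[F] M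
  right : M →ₗ[F] L →ₗ[F] M
  llm : ∀ (x y : L) (m : M), left (x * y) m = left x (left y m) - left y (left x m)
  lml : ∀ (x y : L) (m : M), right (left x m) y = left x (right m y) - right m (x * y)
  mll : ∀ (x y : L) (m : M), right (right m x) y = right m (x * y) - left x (right m y)

/-- The trivial bimodule structure: `x · m = 0 = m · x`. -/
def Bimodule.trivial : Bimodule F L M where
  left := 0
  right := 0
  llm := by simp
  lml := by simp
  mll := by simp

/-- `CLⁿ(L, M) = Hom(L^{⊗ n}, M)`, as the space of `n`-linear maps. -/
abbrev Cochain (n : ℕ) : Type _ := MultilinearMap F (fun _ : Fin n => L) M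

end

section

variable {F : Type*} [Field F]
  {L : Type*} [NonUnitalNonAssocRing L] [Module F L] [IsScalarTower F L L] [SMulCommClass F L L]
  {M : Type*} [AddCommGroup M] [Module F M]

/-- `x₁ ⊗ ⋯ ⊗ xₙ₊₁ ↦ xₚ · f(x₁ ⊗ ⋯ x̂ₚ ⋯ ⊗ xₙ₊₁)` for a bilinear pairing `B`. -/
def actTerm (B : L →ₗ[F] M →ₗ[F] M) {n : ℕ} (p : Fin (n + 1)) (f : Cochain F L M n) :
    Cochain F L M (n + 1) :=
  MultilinearMap.mk' (fun x => B (x p) (f (p.removeNth x)))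
    (by
      intro x k a b
      rcases Fin.eq_self_or_eq_succAbove p k with rfl | ⟨k, rfl⟩
      · simp
      · simp [Fin.removeNth_update_succAbove])
    (by
      intro x k c a
      rcases Fin.eq_self_or_eq_succAbove p k with rfl | ⟨k, rfl⟩
      · simp
      · simp [Fin.removeNth_update_succAbove])

/-- `x₁ ⊗ ⋯ ⊗ xₙ₊₁ ↦ f(x₁ ⊗ ⋯ x̂ᵢ ⋯ ⊗ xⱼ₋₁ ⊗ xᵢxⱼ ⊗ xⱼ₊₁ ⊗ ⋯ ⊗ xₙ₊₁)`, where `j = i.succAbove k`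
is the position, in the original tuple, of the `k`-th of the entries that remain when the `i`-th
entry is removed. -/
def mulTerm {n : ℕ} (i : Fin (n + 1)) (k : Fin n) (f : Cochain F L M n) :
    Cochain F L M (n + 1) :=
  MultilinearMap.mk'
    (fun x => f (Function.update (i.removeNth x) k (x i * x (i.succAbove k))))
    (by
      intro x l a b
      rcases Fin.eq_self_or_eq_succAbove i l with rfl | ⟨l, rfl⟩
      · simp [add_mul]
      · rcases eq_or_ne k l with rfl | h
        · simp [mul_add]
        · simp [Fin.removeNth_update_succAbove, h, Function.update_comm h.symm])
    (by
      intro x l c a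
      rcases Fin.eq_self_or_eq_succAbove i l with rfl | ⟨l, rfl⟩
      · simp [smul_mul_assoc]
      · rcases eq_or_ne k l with rfl | h
        · simp [mul_smul_comm]
        · simp [Fin.removeNth_update_succAbove, h, Function.update_comm h.symm])

/-- The coboundary operator `dⁿ : CLⁿ(L, M) → CLⁿ⁺¹(L, M)`.  With entries numbered from `1`, it is
`(dⁿf)(x₁ ⊗ ⋯ ⊗ xₙ₊₁) = ∑_{1 ≤ j ≤ n} (-1)^(j+1) xⱼ · f(x₁ ⊗ ⋯ x̂ⱼ ⋯ ⊗ xₙ₊₁)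
  + (-1)^(n+1) f(x₁ ⊗ ⋯ ⊗ xₙ) · xₙ₊₁
  + ∑_{1 ≤ i < j ≤ n+1} (-1)^i f(x₁ ⊗ ⋯ x̂ᵢ ⋯ ⊗ xⱼ₋₁ ⊗ xᵢxⱼ ⊗ xⱼ₊₁ ⊗ ⋯ ⊗ xₙ₊₁)`.
In Lean the entries are numbered from `0`, and the last sum runs over the pairs `(i, k)` for which
the position `j = i.succAbove k` of the entry that is multiplied by `xᵢ` exceeds `i`. -/
def coboundary (B : Bimodule F L M) (n : ℕ) : Cochain F L M n →ₗ[F] Cochain F L M (n + 1) where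
  toFun f :=
    (∑ j : Fin n, (-1 : F) ^ (j : ℕ) • actTerm B.left j.castSucc f)
      + (-1 : F) ^ (n + 1) • actTerm B.right.flip (Fin.last n) f
      + ∑ i : Fin (n + 1), ∑ k : Fin n with i < i.succAbove k,
          (-1 : F) ^ ((i : ℕ) + 1) • mulTerm i k f
  map_add' f g := by
    ext x
    simp [actTerm, mulTerm, Finset.sum_add_distrib]
    abel
  map_smul' c f := by
    ext x
    simp [actTerm, mulTerm, Finset.smul_sum, smul_comm c]

/-- `ZLⁿ(L, M) = Ker dⁿ`. -/
def cocycles (B : Bimodule F L M) (n : ℕ) : Submodule F (Cochain F L M n) :=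
  LinearMap.ker (coboundary B n)

/-- `BLⁿ(L, M) = Im dⁿ⁻¹`, where `d⁻¹ = 0`. -/
def coboundaries (B : Bimodule F L M) : (n : ℕ) → Submodule F (Cochain F L M n)
  | 0 => ⊥
  | n + 1 => LinearMap.range (coboundary B n)

/-- `HLⁿ(L, M) = ZLⁿ(L, M) / BLⁿ(L, M)`, where `BLⁿ(L, M)` is regarded as a subspace of
`ZLⁿ(L, M)`. -/
abbrev HL (B : Bimodule F L M) (n : ℕ) : Type _ :=
  cocycles B n ⧸ (coboundaries B n).submoduleOf (cocycles B n)

end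

end LeibnizCoh

/-! Degree 0 is clear: `d⁰ = 0` for trivial coefficients, so constants survive. In positive degree,
vanishing is pushed down until it contradicts this. Nilpotency gives `z ≠ 0` with `x * z = 0` for
all `x`, so evaluation at `z` is a coinvariant surjection from the coadjoint module `L*` onto `F`.
Suppose `HLⁿ⁺¹(L, F) = 0`. By dévissage (`Vanishes.of_trivial`), degree `n + 1` cohomology vanishes
for the kernel of this evaluation, so each `n`-cocycle `g` over `F` lifts to an `n`-cocycle over
`L*`. Under `CLⁿ(L, L*) ≅ CLⁿ⁺¹(L, F)`, which respects differentials (`diff_shift`), the lift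
becomes a cocycle, hence some `d u`. For `n = 0` this forces `g = 0`, absurd for `g = 1`; for `n >
0` it makes `g` a coboundary, so `HLⁿ(L, F) = 0` (`not_vanishes`). -/

namespace LeibnizCoh

/-! ### Cartan calculus on cochains. -/

section Complex

variable {F : Type*} [Field F] {L : Type*} [NonUnitalNonAssocRing L] [Module F L]
  {M : Type*} [AddCommGroup M] [Module F M]
  {N : Type*} [AddCommGroup N] [Module F N]

/-- Currying of the first argument of a cochain. -/
def cur (F L M : Type*) [Field F] [NonUnitalNonAssocRing L] [Module F L] [AddCommGroup M]
    [Module F M] (n : ℕ) : Cochain F L M (n + 1) ≃ₗ[F] (L →ₗ[F] Cochain F L M n) :=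
  multilinearCurryLeftEquiv F (fun _ : Fin (n + 1) => L) M

@[simp]
theorem cur_apply {n : ℕ} (f : Cochain F L M (n + 1)) (x : L) (v : Fin n → L) :
    cur F L M n f x v = f (Fin.cons x v) := rfl

theorem cur_ext {n : ℕ} {f g : Cochain F L M (n + 1)}
    (h : ∀ x, cur F L M n f x = cur F L M n g x) : f = g :=
  (cur F L M n).injective (LinearMap.ext h)

/-- Composition of cochains with a linear map of the coefficients. -/
abbrev post (p : M →ₗ[F] N) (n : ℕ) (f : Cochain F L M n) : Cochain F L N n :=
  p.compMultilinearMap f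

theorem cur_post (p : M →ₗ[F] N) (n : ℕ) (f : Cochain F L M (n + 1)) (x : L) :
    cur F L N n (post p (n + 1) f) x = post p n (cur F L M n f x) := rfl

theorem post_sub (p : M →ₗ[F] N) (n : ℕ) (f g : Cochain F L M n) :
    post p n (f - g) = post p n f - post p n g := by
  ext; simp

/-- Moving the last argument of a cochain to the coefficients. -/
def shift (F L : Type*) [Field F] [NonUnitalNonAssocRing L] [Module F L] :
    (n : ℕ) → Cochain F L F (n + 1) ≃ₗ[F] Cochain F L (Module.Dual F L) n
  | 0 => cur F L F 0 ≪≫ₗ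
      LinearEquiv.congrRight (MultilinearMap.constLinearEquivOfIsEmpty F F _ _).symm ≪≫ₗ
      MultilinearMap.constLinearEquivOfIsEmpty F F _ _
  | n + 1 => cur F L F (n + 1) ≪≫ₗ LinearEquiv.congrRight (shift F L n) ≪≫ₗ
      (cur F L (Module.Dual F L) n).symm

theorem shift_zero_apply (f : Cochain F L F 1) (v : Fin 0 → L) (y : L) :
    shift F L 0 f v y = cur F L F 0 f y 0 := rfl

@[simp]
theorem cur_shift (n : ℕ) (f : Cochain F L F (n + 2)) (x : L) :
    cur F L (Module.Dual F L) n (shift F L (n + 1) f) x = shift F L n (cur F L F (n + 1) f x) := by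
  simp only [shift, LinearEquiv.trans_apply, LinearEquiv.apply_symm_apply]
  rfl

variable [IsScalarTower F L L] [SMulCommClass F L L]

/-- The Lie derivative of cochains with values in a left module. -/
def lieDer (ρ : L →ₗ[F] Module.End F M) :
    (n : ℕ) → L →ₗ[F] Cochain F L M n →ₗ[F] Cochain F L M n
  | 0 => LinearMap.mk₂ F (fun x f => (ρ x).compMultilinearMap f)
      (by intros; ext; simp) (by intros; ext; simp) (by intros; ext; simp) (by intros; ext; simp)
  | n + 1 => LinearMap.mk₂ F
      (fun x f => (cur F L M n).symm
        (lieDer ρ n x ∘ₗ cur F L M n f - cur F L M n f ∘ₗ LinearMap.mulLeft F x))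
      (by intros; apply cur_ext; intro y; simp [add_mul]; abel)
      (by intros; apply cur_ext; intro y; simp [smul_mul_assoc, smul_sub])
      (by intros; apply cur_ext; intro y; simp; abel)
      (by intros; apply cur_ext; intro y; simp [smul_sub])

theorem lieDer_zero_apply (ρ : L →ₗ[F] Module.End F M) (x : L) (f : Cochain F L M 0)
    (v : Fin 0 → L) : lieDer ρ 0 x f v = ρ x (f v) := rfl

@[simp]
theorem cur_lieDer (ρ : L →ₗ[F] Module.End F M) (n : ℕ) (x y : L) (f : Cochain F L M (n + 1)) :
    cur F L M n (lieDer ρ (n + 1) x f) y =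
      lieDer ρ n x (cur F L M n f y) - cur F L M n f (x * y) := by
  simp [lieDer]

/-- The coboundary operator for cochains with values in a left module, regarded as a symmetric
bimodule, given by Cartan's formula. -/
def diff (ρ : L →ₗ[F] Module.End F M) :
    (n : ℕ) → Cochain F L M n →ₗ[F] Cochain F L M (n + 1)
  | 0 => (cur F L M 0).symm.toLinearMap ∘ₗ (lieDer ρ 0).flip
  | n + 1 => (cur F L M (n + 1)).symm.toLinearMap ∘ₗ
      ((lieDer ρ (n + 1)).flip - (LinearMap.compRight F (diff ρ n)) ∘ₗ (cur F L M n).toLinearMap)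

@[simp]
theorem cur_diff_zero (ρ : L →ₗ[F] Module.End F M) (x : L) (f : Cochain F L M 0) :
    cur F L M 0 (diff ρ 0 f) x = lieDer ρ 0 x f := by
  simp [diff]

@[simp]
theorem cur_diff_succ (ρ : L →ₗ[F] Module.End F M) (n : ℕ) (x : L) (f : Cochain F L M (n + 1)) :
    cur F L M (n + 1) (diff ρ (n + 1) f) x =
      lieDer ρ (n + 1) x f - diff ρ n (cur F L M n f x) := by
  simp [diff]

/-- `ρ` is a left module structure over the left Leibniz algebra `L`. -/
def IsRep (ρ : L →ₗ[F] Module.End F M) : Prop :=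
  ∀ (x y : L) (m : M), ρ (x * y) m = ρ x (ρ y m) - ρ y (ρ x m)

theorem lieDer_mul [IsLeftLeibniz L] {ρ : L →ₗ[F] Module.End F M} (hρ : IsRep ρ) (n : ℕ) (x y : L)
    (f : Cochain F L M n) :
    lieDer ρ n (x * y) f = lieDer ρ n x (lieDer ρ n y f) - lieDer ρ n y (lieDer ρ n x f) := by
  induction n with
  | zero =>
    ext v
    simp [lieDer_zero_apply, hρ x y]
  | succ n ih =>
    apply cur_ext
    intro z
    simp only [cur_lieDer, map_sub, LinearMap.sub_apply, ih, IsLeftLeibniz.leibniz x y z, map_add]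
    abel

/-- With `ι` denoting `cur`, this follows from `ι_y d = L_y - d ι_y`, `[L_x, ι_y] = ι_{xy}` and
`[L_x, L_y] = L_{xy}`. -/
theorem lieDer_diff [IsLeftLeibniz L] {ρ : L →ₗ[F] Module.End F M} (hρ : IsRep ρ) (n : ℕ) (x : L)
    (f : Cochain F L M n) : lieDer ρ (n + 1) x (diff ρ n f) = diff ρ n (lieDer ρ n x f) := by
  induction n with
  | zero =>
    apply cur_ext
    intro y
    simp [lieDer_mul hρ]
  | succ n ih =>
    apply cur_ext
    intro y
    rw [cur_lieDer, cur_diff_succ, cur_diff_succ, cur_diff_succ, cur_lieDer, map_sub, map_sub, ih,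
      lieDer_mul hρ]
    abel

theorem diff_diff [IsLeftLeibniz L] {ρ : L →ₗ[F] Module.End F M} (hρ : IsRep ρ) (n : ℕ)
    (f : Cochain F L M n) : diff ρ (n + 1) (diff ρ n f) = 0 := by
  induction n with
  | zero =>
    apply cur_ext
    intro x
    rw [cur_diff_succ, cur_diff_zero, lieDer_diff hρ]
    simp
  | succ n ih =>
    apply cur_ext
    intro x
    rw [cur_diff_succ, cur_diff_succ, lieDer_diff hρ, map_sub, ih]
    simp

theorem lieDer_post {ρ : L →ₗ[F] Module.End F M} {σ : L →ₗ[F] Module.End F N} {p : M →ₗ[F] N}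
    (hp : ∀ x m, p (ρ x m) = σ x (p m)) (n : ℕ) (x : L) (f : Cochain F L M n) :
    lieDer σ n x (post p n f) = post p n (lieDer ρ n x f) := by
  induction n with
  | zero =>
    ext v
    simp [lieDer_zero_apply, hp]
  | succ n ih =>
    apply cur_ext
    intro y
    rw [cur_lieDer, cur_post, cur_post, cur_post, cur_lieDer, ih, post_sub]

theorem diff_post {ρ : L →ₗ[F] Module.End F M} {σ : L →ₗ[F] Module.End F N} {p : M →ₗ[F] N}
    (hp : ∀ x m, p (ρ x m) = σ x (p m)) (n : ℕ) (f : Cochain F L M n) :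
    diff σ n (post p n f) = post p (n + 1) (diff ρ n f) := by
  induction n with
  | zero =>
    apply cur_ext
    intro x
    rw [cur_diff_zero, lieDer_post hp, cur_post, cur_diff_zero]
  | succ n ih =>
    apply cur_ext
    intro y
    rw [cur_diff_succ, cur_post, cur_post, cur_diff_succ, ih, lieDer_post hp, post_sub]

theorem lieDer_zero_eq (n : ℕ) (x : L) (f : Cochain F L M n) (v : Fin n → L) :
    lieDer (0 : L →ₗ[F] Module.End F M) n x f v =
      -∑ k, f (Function.update v k (x * v k)) := by
  induction n with
  | zero => simp [lieDer_zero_apply]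
  | succ n ih =>
    obtain ⟨y, w, rfl⟩ : ∃ y w, v = Fin.cons y w := ⟨v 0, Fin.tail v, (Fin.cons_self_tail v).symm⟩
    rw [← cur_apply, cur_lieDer, sub_apply, ih, Fin.sum_univ_succ]
    simp only [cur_apply, Fin.cons_zero, Fin.cons_succ, Fin.update_cons_zero, ← Fin.cons_update]
    abel

theorem coboundary_trivial_apply (n : ℕ) (f : Cochain F L M n) (v : Fin (n + 1) → L) :
    coboundary (Bimodule.trivial F L M) n f v =
      ∑ i : Fin (n + 1), ∑ k : Fin n, if i < i.succAbove k then
        (-1 : F) ^ ((i : ℕ) + 1) •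
          f (Function.update (i.removeNth v) k (v i * v (i.succAbove k))) else 0 := by
  simp only [coboundary, Bimodule.trivial, actTerm, mulTerm, Finset.sum_filter]
  simp only [LinearMap.coe_mk, AddHom.coe_mk, add_apply, sum_apply]
  simp only [smul_apply, MultilinearMap.mk'_apply, LinearMap.zero_apply, smul_zero,
    Finset.sum_const_zero, zero_add, LinearMap.flip_apply]
  refine Finset.sum_congr rfl fun i _ => Finset.sum_congr rfl fun k _ => ?_
  split_ifs <;> rfl

/-- Removing the first entry (`i = 0`) yields the Lie derivative; the other terms keep that entry
and yield `-d ι_y`. This is Cartan's formula. -/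
theorem coboundary_trivial (n : ℕ) :
    coboundary (Bimodule.trivial F L M) n = diff (0 : L →ₗ[F] Module.End F M) n := by
  induction n with
  | zero =>
    ext f v
    obtain ⟨y, w, rfl⟩ : ∃ y w, v = Fin.cons y w := ⟨v 0, Fin.tail v, (Fin.cons_self_tail v).symm⟩
    rw [← cur_apply (diff _ _ _), cur_diff_zero, lieDer_zero_apply, coboundary_trivial_apply]
    simp
  | succ n ih =>
    ext f v
    obtain ⟨y, w, rfl⟩ : ∃ y w, v = Fin.cons y w := ⟨v 0, Fin.tail v, (Fin.cons_self_tail v).symm⟩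
    rw [← cur_apply (diff _ _ _), cur_diff_succ, ← ih, sub_apply,
      lieDer_zero_eq, coboundary_trivial_apply, coboundary_trivial_apply, Fin.sum_univ_succ,
      sub_eq_add_neg, ← Finset.sum_neg_distrib, ← Finset.sum_neg_distrib]
    congr 1
    · refine Finset.sum_congr rfl fun k _ => ?_
      simp
    · refine Finset.sum_congr rfl fun i _ => ?_
      rw [Fin.sum_univ_succ, ← Finset.sum_neg_distrib]
      -- For `k = 0` the position `j = 0` lies before `i.succ`, so this term is absent.
      simp only [Fin.succ_succAbove_zero, Fin.not_lt_zero, if_false, zero_add]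
      refine Finset.sum_congr rfl fun k _ => ?_
      have h : i.succ.removeNth (Fin.cons y w : Fin (n + 2) → L) = Fin.cons y (i.removeNth w) := by
        ext j
        refine Fin.cases ?_ (fun j => ?_) j <;> simp [Fin.removeNth]
      simp only [Fin.succ_succAbove_succ, Fin.succ_lt_succ_iff, Fin.cons_succ, h, ← Fin.cons_update,
        cur_apply, Fin.val_succ]
      split_ifs <;> simp [pow_succ]

/-! ### Trading the last argument for coadjoint coefficients. -/

/-- The left module dual to the left adjoint module. -/
def coadj (F L : Type*) [Field F] [NonUnitalNonAssocRing L] [Module F L] [IsScalarTower F L L]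
    [SMulCommClass F L L] : L →ₗ[F] Module.End F (Module.Dual F L) :=
  LinearMap.mk₂ F (fun x φ => -(φ ∘ₗ LinearMap.mulLeft F x))
    (by intros; ext; simp [add_mul]; abel) (by intros; ext; simp [smul_mul_assoc])
    (by intros; ext; simp; abel) (by intros; ext; simp)

@[simp]
theorem coadj_apply (x y : L) (φ : Module.Dual F L) : coadj F L x φ y = -φ (x * y) := rfl

theorem isRep_coadj [IsLeftLeibniz L] : IsRep (coadj F L) := by
  intro x y φ
  ext z
  simp [IsLeftLeibniz.leibniz x y z]

theorem lieDer_shift (n : ℕ) (x : L) (f : Cochain F L F (n + 1)) :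
    lieDer (coadj F L) n x (shift F L n f) = shift F L n (lieDer 0 (n + 1) x f) := by
  induction n with
  | zero =>
    ext v y
    rw [lieDer_zero_apply, coadj_apply, shift_zero_apply, shift_zero_apply, cur_lieDer,
      sub_apply, lieDer_zero_apply]
    simp
  | succ n ih =>
    apply cur_ext
    intro y
    rw [cur_lieDer, cur_shift, cur_shift, cur_shift, cur_lieDer, ih, map_sub]

theorem diff_zero_zero (f : Cochain F L M 0) : diff (0 : L →ₗ[F] Module.End F M) 0 f = 0 := by
  apply cur_ext
  intro x
  ext v
  simp [lieDer_zero_apply]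

/-- With trivial coefficients the last argument is never removed; it only gets multiplied on the
left by earlier ones, which is the coadjoint action up to sign. -/
theorem diff_shift (n : ℕ) (f : Cochain F L F (n + 1)) :
    diff (coadj F L) n (shift F L n f) = shift F L (n + 1) (diff 0 (n + 1) f) := by
  induction n with
  | zero =>
    apply cur_ext
    intro x
    rw [cur_diff_zero, cur_shift, cur_diff_succ, diff_zero_zero, sub_zero, lieDer_shift]
  | succ n ih =>
    apply cur_ext
    intro x
    rw [cur_diff_succ, cur_shift, cur_shift, cur_diff_succ, ih, lieDer_shift, map_sub]

end Complex

end LeibnizCoh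

namespace LeibnizCoh

/-! ### Dévissage along coinvariant functionals, and descent in degree. -/

section Devissage

variable {F : Type*} [Field F]
  {L : Type*} [NonUnitalNonAssocRing L] [Module F L]
  {M : Type*} [AddCommGroup M] [Module F M]

/-- Some product of sufficiently many operators of the representation vanishes. -/
def IsNilpotentRep (ρ : L →ₗ[F] Module.End F M) : Prop :=
  ∃ k : ℕ, ∀ l : List L, l.length = k → (l.map ρ).prod = 0

/-- If the vectors `ρ x m` spanned `M`, the nilpotency length could be lowered step by step to 0,
giving `1 = 0` on `M`. -/
theorem IsNilpotentRep.exists_coinvariant [Nontrivial M] {ρ : L →ₗ[F] Module.End F M}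
    (h : IsNilpotentRep ρ) : ∃ p : M →ₗ[F] F, p ≠ 0 ∧ ∀ x m, p (ρ x m) = 0 := by
  by_cases htop : Submodule.span F {m : M | ∃ x m', ρ x m' = m} = ⊤
  · exfalso
    obtain ⟨k, hk⟩ := h
    induction k with
    | zero => simpa using hk [] rfl
    | succ k ih =>
      refine ih fun l hl => LinearMap.ext_on htop ?_
      rintro _ ⟨x, m, rfl⟩
      have := LinearMap.congr_fun (hk (l ++ [x]) (by simp [hl])) m
      simpa using this
  · obtain ⟨p, hp, hle⟩ := Submodule.exists_le_ker_of_lt_top _ (lt_top_iff_ne_top.2 htop)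
    exact ⟨p, hp, fun x m => hle (Submodule.subset_span ⟨x, m, rfl⟩)⟩

/-- The restriction of a representation to the kernel of a coinvariant functional. -/
def kerRep (ρ : L →ₗ[F] Module.End F M) (p : M →ₗ[F] F) (hp : ∀ x m, p (ρ x m) = 0) :
    L →ₗ[F] Module.End F (LinearMap.ker p) :=
  LinearMap.mk₂ F (fun x m => ⟨ρ x m, hp x m⟩)
    (by intros; ext; simp) (by intros; ext; simp) (by intros; ext; simp) (by intros; ext; simp)

@[simp]
theorem coe_kerRep (ρ : L →ₗ[F] Module.End F M) (p : M →ₗ[F] F) (hp : ∀ x m, p (ρ x m) = 0)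
    (x : L) (m : LinearMap.ker p) : (kerRep ρ p hp x m : M) = ρ x m := rfl

theorem IsNilpotentRep.kerRep {ρ : L →ₗ[F] Module.End F M} (h : IsNilpotentRep ρ)
    {p : M →ₗ[F] F} (hp : ∀ x m, p (ρ x m) = 0) : IsNilpotentRep (kerRep ρ p hp) := by
  obtain ⟨k, hk⟩ := h
  refine ⟨k, fun l hl => LinearMap.ext fun m => Subtype.ext ?_⟩
  have key : ∀ l : List L, (((l.map (LeibnizCoh.kerRep ρ p hp)).prod m : LinearMap.ker p) : M) =
      (l.map ρ).prod (m : M) := by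
    intro l
    induction l with
    | nil => simp
    | cons x l ih => simp [ih]
  rw [key, hk l hl]
  simp

theorem IsRep.kerRep {ρ : L →ₗ[F] Module.End F M} (h : IsRep ρ) {p : M →ₗ[F] F}
    (hp : ∀ x m, p (ρ x m) = 0) : IsRep (kerRep ρ p hp) :=
  fun x y m => Subtype.ext (by simp [h x y])

/-- Cochains with values in the kernel of a functional. -/
theorem exists_post_subtype {p : M →ₗ[F] F} {n : ℕ} {h : Cochain F L M n} (hh : post p n h = 0) :
    ∃ h' : Cochain F L (LinearMap.ker p) n, post (LinearMap.ker p).subtype n h' = h :=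
  ⟨h.codRestrict _ fun v => by simpa using congrArg (fun f => f v) hh, by ext; simp⟩

theorem exists_post_eq {p : M →ₗ[F] F} (hp : p ≠ 0) {n : ℕ} (u : Cochain F L F n) :
    ∃ u' : Cochain F L M n, post p n u' = u := by
  obtain ⟨m, hm⟩ : ∃ m, p m = 1 := LinearMap.surjective hp 1
  exact ⟨post (LinearMap.toSpanSingleton F M m) n u, by ext; simp [hm]⟩

theorem post_subtype_injective {p : M →ₗ[F] F} {n : ℕ} :
    Function.Injective (post (L := L) (LinearMap.ker p).subtype n) := fun f g hfg => by
  ext v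
  simpa using congrArg (fun f => f v) hfg

variable [IsScalarTower F L L] [SMulCommClass F L L]

/-- Every cocycle of degree `n + 1` is a coboundary. -/
def Vanishes (ρ : L →ₗ[F] Module.End F M) (n : ℕ) : Prop :=
  ∀ h : Cochain F L M (n + 1), diff ρ (n + 1) h = 0 → ∃ k, diff ρ n k = h

theorem diff_post_functional {ρ : L →ₗ[F] Module.End F M} {p : M →ₗ[F] F}
    (hp : ∀ x m, p (ρ x m) = 0) (n : ℕ) (f : Cochain F L M n) :
    diff 0 n (post p n f) = post p (n + 1) (diff ρ n f) :=
  diff_post (by simpa using hp) n f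

theorem diff_post_subtype {ρ : L →ₗ[F] Module.End F M} {p : M →ₗ[F] F}
    (hp : ∀ x m, p (ρ x m) = 0) (n : ℕ) (f : Cochain F L (LinearMap.ker p) n) :
    diff ρ n (post (LinearMap.ker p).subtype n f) =
      post (LinearMap.ker p).subtype (n + 1) (diff (kerRep ρ p hp) n f) :=
  diff_post (fun _ _ => rfl) n f

/-- A cocycle that takes values in the kernel of a coinvariant functional is the coboundary of such
a cochain. -/
theorem Vanishes.exists_of_post_eq_zero {ρ : L →ₗ[F] Module.End F M} {p : M →ₗ[F] F}
    {hp : ∀ x m, p (ρ x m) = 0} {n : ℕ} (hV : Vanishes (kerRep ρ p hp) n)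
    {h : Cochain F L M (n + 1)} (hh : post p (n + 1) h = 0) (hd : diff ρ (n + 1) h = 0) :
    ∃ k, post p n k = 0 ∧ diff ρ n k = h := by
  obtain ⟨h', rfl⟩ := exists_post_subtype hh
  rw [diff_post_subtype hp] at hd
  obtain ⟨k, rfl⟩ := hV h' (post_subtype_injective (hd.trans (by ext; simp)))
  exact ⟨post (LinearMap.ker p).subtype n k, by ext; simp, diff_post_subtype hp n k⟩

variable [IsLeftLeibniz L]

/-- Exactness in the middle of `Hⁿ⁺¹(ker p) → Hⁿ⁺¹(M) → Hⁿ⁺¹(F)`, by a direct chase. -/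
theorem Vanishes.of_ker {ρ : L →ₗ[F] Module.End F M} (hρ : IsRep ρ) {p : M →ₗ[F] F} (hp0 : p ≠ 0)
    {hp : ∀ x m, p (ρ x m) = 0} {n : ℕ} (hV : Vanishes (kerRep ρ p hp) n)
    (hF : Vanishes (0 : L →ₗ[F] Module.End F F) n) : Vanishes ρ n := by
  intro h hh
  obtain ⟨u, hu⟩ := hF (post p (n + 1) h) (by
    rw [diff_post_functional hp, hh]
    ext
    simp)
  obtain ⟨u', rfl⟩ := exists_post_eq hp0 u
  obtain ⟨k, -, hk⟩ := hV.exists_of_post_eq_zero (h := h - diff ρ n u')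
    (by rw [post_sub, ← diff_post_functional hp, hu, sub_self])
    (by rw [map_sub, hh, diff_diff hρ, sub_self])
  exact ⟨u' + k, by rw [map_add, hk, add_sub_cancel]⟩

/-- The connecting map `Hⁿ(F) → Hⁿ⁺¹(ker p)` has zero target; `k` corrects an arbitrary lift. -/
theorem Vanishes.exists_cocycle_lift {ρ : L →ₗ[F] Module.End F M} (hρ : IsRep ρ) {p : M →ₗ[F] F}
    (hp0 : p ≠ 0) {hp : ∀ x m, p (ρ x m) = 0} {n : ℕ} (hV : Vanishes (kerRep ρ p hp) n)
    {g : Cochain F L F n} (hg : diff 0 n g = 0) : ∃ f, diff ρ n f = 0 ∧ post p n f = g := by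
  obtain ⟨g', rfl⟩ := exists_post_eq hp0 g
  obtain ⟨k, hk0, hk⟩ := hV.exists_of_post_eq_zero (h := diff ρ n g')
    (by rw [← diff_post_functional hp, hg]) (diff_diff hρ n g')
  exact ⟨g' - k, by rw [map_sub, hk, sub_self], by rw [post_sub, hk0, sub_zero]⟩

theorem Vanishes.of_trivial {n : ℕ} (hF : Vanishes (0 : L →ₗ[F] Module.End F F) n) (d : ℕ) :
    ∀ {M : Type*} [AddCommGroup M] [Module F M] [FiniteDimensional F M]
      {ρ : L →ₗ[F] Module.End F M}, IsRep ρ → IsNilpotentRep ρ → Module.finrank F M = d →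
      Vanishes ρ n := by
  induction d with
  | zero =>
    intro M _ _ _ ρ _ _ hd h _
    have := Module.finrank_zero_iff.1 hd
    exact ⟨0, by ext; exact Subsingleton.elim _ _⟩
  | succ d ih =>
    intro M _ _ _ ρ hρ hn hd
    have : Nontrivial M := Module.nontrivial_of_finrank_pos (R := F) (by omega)
    obtain ⟨p, hp0, hp⟩ := hn.exists_coinvariant
    refine Vanishes.of_ker hρ hp0 (ih (hρ.kerRep hp) (hn.kerRep hp) ?_) hF
    have := Module.Dual.finrank_ker_add_one_of_ne_zero hp0
    omega

theorem exists_shift_of_vanishes [FiniteDimensional F L] (hn : IsNilpotentRep (coadj F L))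
    {z : L} (hz : z ≠ 0) (hz' : ∀ x, x * z = 0) {n : ℕ}
    (hF : Vanishes (0 : L →ₗ[F] Module.End F F) n) {g : Cochain F L F n} (hg : diff 0 n g = 0) :
    ∃ u, g = post (Module.Dual.eval F L z) n (shift F L n (diff 0 n u)) := by
  have hp : ∀ x (φ : Module.Dual F L), Module.Dual.eval F L z (coadj F L x φ) = 0 := by
    simp [hz']
  have hp0 : Module.Dual.eval F L z ≠ 0 := fun h =>
    hz ((Module.forall_dual_apply_eq_zero_iff F z).1 fun φ => LinearMap.congr_fun h φ)
  have hV : Vanishes (kerRep (coadj F L) _ hp) n :=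
    Vanishes.of_trivial (M := LinearMap.ker (Module.Dual.eval F L z)) hF _ (isRep_coadj.kerRep hp) (hn.kerRep hp) rfl
  obtain ⟨f, hf, rfl⟩ := hV.exists_cocycle_lift isRep_coadj hp0 hg
  obtain ⟨w, rfl⟩ := (shift F L n).surjective f
  obtain ⟨u, rfl⟩ := hF w ((shift F L (n + 1)).injective (by rw [← diff_shift, hf, map_zero]))
  exact ⟨u, rfl⟩

theorem not_vanishes [FiniteDimensional F L] (hn : IsNilpotentRep (coadj F L))
    {z : L} (hz : z ≠ 0) (hz' : ∀ x, x * z = 0) (n : ℕ) :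
    ¬ Vanishes (0 : L →ₗ[F] Module.End F F) n := by
  induction n with
  | zero =>
    intro hF
    obtain ⟨u, hu⟩ := exists_shift_of_vanishes hn hz hz' hF
      (diff_zero_zero (MultilinearMap.constOfIsEmpty F (fun _ : Fin 0 => L) (1 : F)))
    -- Here `u` has degree 0, so `d u = 0` and the constant cochain 1 would vanish.
    rw [diff_zero_zero, map_zero] at hu
    simpa using congrArg (fun f => f 0) hu
  | succ n ih =>
    refine fun hF => ih fun g hg => ?_
    obtain ⟨u, rfl⟩ := exists_shift_of_vanishes hn hz hz' hF hg
    refine ⟨post (Module.Dual.eval F L z) n (shift F L n u), ?_⟩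
    rw [← diff_shift]
    exact diff_post_functional (by simp [hz']) _ _

end Devissage

/-! ### Consequences of nilpotency for left multiplications. -/

section Nilpotent

variable {F : Type*} [Field F]
  {L : Type*} [NonUnitalNonAssocRing L] [Module F L] [IsScalarTower F L L] [SMulCommClass F L L]

theorem IsNilpotentAlg.exists_foldr (hL : IsNilpotentAlg L) :
    ∃ k : ℕ, ∀ l : List L, l.length = k → ∀ y : L, l.foldr (· * ·) y = 0 := by
  obtain ⟨r, hr, h⟩ := hL
  -- The innermost factor `y` is the `r`-th letter of the word.
  refine ⟨r - 1, fun l hl y => ?_⟩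
  have hw : ∀ l : List L, (l.foldr (fun x w => FreeMagma.of x * w) (FreeMagma.of y)).length =
      l.length + 1 ∧ FreeMagma.lift (id : L → L)
        (l.foldr (fun x w => FreeMagma.of x * w) (FreeMagma.of y)) = l.foldr (· * ·) y := by
    intro l
    induction l with
    | nil => exact ⟨rfl, rfl⟩
    | cons x l ih =>
      refine ⟨?_, ?_⟩
      · change 1 + _ = _
        rw [ih.1, List.length_cons, add_comm]
      · rw [List.foldr_cons, map_mul, ih.2]
        rfl
  rw [← (hw l).2]
  exact h _ (by rw [(hw l).1]; omega)

/-- A nonzero right-normed product of maximal length is killed by every left multiplication. -/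
theorem IsNilpotentAlg.exists_right_annihilated [Nontrivial L] (hL : IsNilpotentAlg L) :
    ∃ z : L, z ≠ 0 ∧ ∀ x, x * z = 0 := by
  obtain ⟨k, hk⟩ := hL.exists_foldr
  obtain ⟨y, hy⟩ := exists_ne (0 : L)
  induction k with
  | zero => exact absurd (hk [] rfl y) hy
  | succ k ih =>
    by_cases h : ∀ l : List L, l.length = k → ∀ y : L, l.foldr (· * ·) y = 0
    · exact ih h
    · push Not at h
      obtain ⟨l, hl, y, hy⟩ := h
      exact ⟨_, hy, fun x => hk (x :: l) (by simp [hl]) y⟩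

theorem IsNilpotentAlg.isNilpotentRep_coadj (hL : IsNilpotentAlg L) :
    IsNilpotentRep (coadj F L) := by
  obtain ⟨k, hk⟩ := hL.exists_foldr
  refine ⟨k, fun l hl => ?_⟩
  -- Dualizing reverses the order of the operators, and each one contributes a sign.
  have key : ∀ (l : List L) (φ : Module.Dual F L) (y : L), (l.map (coadj F L)).prod φ y =
      (-1) ^ l.length * φ (l.reverse.foldr (· * ·) y) := by
    intro l
    induction l with
    | nil => simp
    | cons x l ih => intro φ y; simp [ih, pow_succ]
  ext φ y
  rw [key, hk _ (by simpa using hl)]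
  simp

end Nilpotent

end LeibnizCoh

theorem corollary4p5 (F : Type*) [Field F]
    (L : Type*) [NonUnitalNonAssocRing L] [Module F L] [IsScalarTower F L L] [SMulCommClass F L L]
    [LeibnizCoh.IsLeftLeibniz L] [FiniteDimensional F L] [Nontrivial L]
    (hL : LeibnizCoh.IsNilpotentAlg L) (n : ℕ) :
    Nontrivial (LeibnizCoh.HL (LeibnizCoh.Bimodule.trivial F L F) n) := by
  refine Submodule.Quotient.nontrivial_iff.2 ?_
  rw [ne_eq, Submodule.submoduleOf_eq_top]
  intro hle
  cases n with
  | zero =>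
    have h : MultilinearMap.constOfIsEmpty F (fun _ : Fin 0 => L) (1 : F) ∈
        LeibnizCoh.coboundaries (LeibnizCoh.Bimodule.trivial F L F) 0 := hle (by
      rw [LeibnizCoh.cocycles, LinearMap.mem_ker, LeibnizCoh.coboundary_trivial,
        LeibnizCoh.diff_zero_zero])
    simpa using congrArg (fun f => f 0) ((Submodule.mem_bot F).1 h)
  | succ n =>
    obtain ⟨z, hz, hz'⟩ := hL.exists_right_annihilated
    refine LeibnizCoh.not_vanishes (F := F) hL.isNilpotentRep_coadj hz hz' n fun h hh => ?_
    rw [← LeibnizCoh.coboundary_trivial] at hh ⊢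
    exact hle hh
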